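/- Let $a:\mathbb{R}\to\mathbb{R}$ be a smooth cut-off function supported on $[-2,2]$ and equal to $1$ on $[-1,1]$, let $\alpha\ge 0$ and let $K>0$. Then there are constants $c,C,\gamma_0>0$, depending only on $a$, $\alpha$ and $K$, such that the following holds for all real $\lambda\ge 1$ and $\gamma\ge\gamma_0$ for which $N=\gamma\lambda$ is an integer, and all $p\in[0,1]$ with $$|p-\tfrac12|\le K\,\lambda^{-\alpha/2}\gamma^{-1/2}.$$ Let $\xi_1,\dots,\xi_N$ be $N$ equi-spaced directions on the unit circle of $\mathbb{R}^2$ (consecutive angles differ by $2\pi/N$), let $C_1,\dots,C_N$ be independent random variables, each equal to $+1$ with probability $p$ and to $-1$ with probability $1-p$, and let $$u(x)=\gamma^{-1/2}\lambda^{-1/2}\sum_{j=1}^N C_j\,e^{i\lambda x\cdot\xi_j},\qquad x\in\mathbb{R}^2,$$ be the normalized random wave. Then, with $B=B_{\lambda^{-\alpha}}(0)$, $$c\,\mathrm{Vol}(B)\le \mathbb{E}\Big[\int_{\mathbb{R}^2}a^2(\lambda^{\alpha}|x|)\,|u(x)|^2\,dx\Big]\le C\,\mathrm{Vol}(B),$$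 and likewise for the unsmoothed mass, $$c\,\mathrm{Vol}(B)\le \mathbb{E}\Big[\int_{B}|u(x)|^2\,dx\Big]\le C\,\mathrm{Vol}(B).$$ -/

import Mathlib

open MeasureTheory ProbabilityTheory

noncomputable section

/-- A smooth cut-off function supported on `[-2, 2]` and equal to one on `[-1, 1]`. -/
structure IsSmoothCutoff (a : ℝ → ℝ) : Prop where
  smooth : ContDiff ℝ (⊤ : ℕ∞) a
  support_subset : Function.support a ⊆ Set.Icc (-2) 2
  eq_one : ∀ r ∈ Set.Icc (-1 : ℝ) 1, a r = 1

/-- The `j`-th of `N` equi-spaced directions on the unit circle (angular spacing `2π / N`),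
the direction of index `0` having angle `θ₀`. -/
def direction (N : ℕ) (θ₀ : ℝ) (j : Fin N) : EuclideanSpace ℝ (Fin 2) :=
  !₂[Real.cos (θ₀ + 2 * Real.pi * (j : ℕ) / N), Real.sin (θ₀ + 2 * Real.pi * (j : ℕ) / N)]

/-- Independent flips of an unfair coin: independent random variables, each taking the value `+1`
with probability `p` and the value `-1` with probability `1 - p`. -/
structure IsUnfairCoin {Ω : Type*} [MeasurableSpace Ω] (P : Measure Ω) (p : ℝ) {N : ℕ}
    (C : Fin N → Ω → ℝ) : Prop where
  measurable : ∀ j, Measurable (C j)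
  indep : iIndepFun C P
  prob_one : ∀ j, P {ω | C j ω = 1} = ENNReal.ofReal p
  prob_neg_one : ∀ j, P {ω | C j ω = -1} = ENNReal.ofReal (1 - p)

/-- The wave `u(x) = ∑ⱼ Cⱼ exp(i lam x · ξⱼ)` with coefficients `Cⱼ` and the `N` equi-spaced
directions `ξⱼ`. -/
def wave (lam θ₀ : ℝ) {N : ℕ} (C : Fin N → ℝ) (x : EuclideanSpace ℝ (Fin 2)) : ℂ :=
  ∑ j, (C j : ℂ) * Complex.exp (Complex.I * ((lam * inner ℝ x (direction N θ₀ j) : ℝ) : ℂ))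

/-- The wave multiplied by the normalising prefactor `γ ^ (-1/2) * lam ^ (-1/2)`. -/
def normalizedWave (lam γ θ₀ : ℝ) {N : ℕ} (C : Fin N → ℝ) (x : EuclideanSpace ℝ (Fin 2)) : ℂ :=
  ((γ ^ (-(1 / 2) : ℝ) * lam ^ (-(1 / 2) : ℝ) : ℝ) : ℂ) * wave lam θ₀ C x

/-- The smoothed `L²` mass `∫ a(lam ^ α |x|)² |v(x)|² dx` of `v` on the ball of radius
`lam ^ (-α)` about the origin. -/
def smoothedMass (a : ℝ → ℝ) (lam α : ℝ) (v : EuclideanSpace ℝ (Fin 2) → ℂ) : ℝ :=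
  ∫ x, a (lam ^ α * ‖x‖) ^ 2 * ‖v x‖ ^ 2

/-- The `L²` mass `∫_X |v(x)|² dx` of `v` on the set `X`. -/
def massOn (X : Set (EuclideanSpace ℝ (Fin 2))) (v : EuclideanSpace ℝ (Fin 2) → ℂ) : ℝ :=
  ∫ x in X, ‖v x‖ ^ 2

end

/-! Put `q = (2p-1)²`, the correlation of two distinct flips, and `R = lam ^ (-α)`. Expanding the
square, the expected mass against a weight `w`, divided by `N`, is `(1-q) ∫ w` plus `q/N` times the
mass of the coherent wave with all coefficients `1`.

Lower bound: the coherent term is nonnegative, and `q ≤ 1/2` once `γ` is large.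

Upper bound: dominate `w` by a Gaussian of width `R`. Its Fourier transform at frequency `lam (ξⱼ -
ξₖ)` is `πR² exp(-(lam R sin(π(j-k)/N))²)`, so each row of the quadratic form sums to at most `πR²`
times `2(1 + N/(lam R))`, which is `O(γ/R)` (`sum_range_exp_neg_sin_sq_le`). The hypothesis on `p`
says `q ≤ 4K²R/γ`, exactly cancelling this growth. -/

theorem sq_norm_wave (lam θ₀ : ℝ) {N : ℕ} (C : Fin N → ℝ) (x : EuclideanSpace ℝ (Fin 2)) :
    ‖wave lam θ₀ C x‖ ^ 2 = ∑ j, ∑ k, C j * C k *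
      Real.cos (lam * inner ℝ x (direction N θ₀ j - direction N θ₀ k)) := by
  have hterm : ∀ j, (C j : ℂ) * Complex.exp (Complex.I *
      ((lam * inner ℝ x (direction N θ₀ j) : ℝ) : ℂ)) =
      ⟨C j * Real.cos (lam * inner ℝ x (direction N θ₀ j)),
        C j * Real.sin (lam * inner ℝ x (direction N θ₀ j))⟩ := fun j => by
    rw [mul_comm Complex.I, Complex.exp_mul_I, ← Complex.ofReal_cos, ← Complex.ofReal_sin]
    apply Complex.ext <;> simp [-Complex.ofReal_cos, -Complex.ofReal_sin, -Complex.ofReal_mul]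
  rw [Complex.sq_norm, Complex.normSq_apply, wave]
  simp only [hterm, Complex.re_sum, Complex.im_sum, Finset.sum_mul_sum,
    ← Finset.sum_add_distrib, inner_sub_right, mul_sub, Real.cos_sub]
  exact Finset.sum_congr rfl fun j _ => Finset.sum_congr rfl fun k _ => by ring

/-! ### Second moments of the coin flips. -/

namespace IsUnfairCoin

variable {Ω : Type*} [MeasurableSpace Ω] {P : Measure Ω} [IsProbabilityMeasure P] {p : ℝ} {N : ℕ}
  {C : Fin N → Ω → ℝ}

theorem ae_eq_one_or_neg_one (h : IsUnfairCoin P p C) (hp₀ : 0 ≤ p) (hp₁ : p ≤ 1) (j : Fin N) :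
    ∀ᵐ ω ∂P, C j ω = 1 ∨ C j ω = -1 := by
  have h1 : MeasurableSet {ω | C j ω = 1} := h.measurable j (measurableSet_singleton 1)
  have h2 : MeasurableSet {ω | C j ω = -1} := h.measurable j (measurableSet_singleton (-1))
  have hd : Disjoint {ω | C j ω = 1} {ω | C j ω = -1} := by
    rw [Set.disjoint_left]
    intro ω (hω : C j ω = 1) (hω' : C j ω = -1)
    linarith
  have hP : P ({ω | C j ω = 1} ∪ {ω | C j ω = -1}) = 1 := by
    rw [measure_union hd h2, h.prob_one, h.prob_neg_one,
      ← ENNReal.ofReal_add hp₀ (sub_nonneg.2 hp₁)]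
    simp
  exact (prob_compl_eq_zero_iff (h1.union h2)).2 hP

theorem integral_eq (h : IsUnfairCoin P p C) (hp₀ : 0 ≤ p) (hp₁ : p ≤ 1) (j : Fin N) :
    ∫ ω, C j ω ∂P = 2 * p - 1 := by
  have h1 : MeasurableSet {ω | C j ω = 1} := h.measurable j (measurableSet_singleton 1)
  have hae : C j =ᵐ[P] fun ω => 2 * {ω | C j ω = 1}.indicator 1 ω - 1 := by
    filter_upwards [h.ae_eq_one_or_neg_one hp₀ hp₁ j] with ω hω
    by_cases h' : C j ω = 1
    · simp [h']; norm_num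
    · simp [Set.indicator_of_notMem (s := {ω | C j ω = 1}) h', hω.resolve_left h']
  rw [integral_congr_ae hae, integral_sub, integral_const_mul, integral_indicator_one h1,
    measureReal_def, h.prob_one, ENNReal.toReal_ofReal hp₀]
  · simp
  · exact ((integrable_const (1 : ℝ)).indicator h1).const_mul 2
  · exact integrable_const _

theorem integrable_mul (h : IsUnfairCoin P p C) (hp₀ : 0 ≤ p) (hp₁ : p ≤ 1) (j k : Fin N) :
    Integrable (fun ω => C j ω * C k ω) P := by
  refine Integrable.of_bound ((h.measurable j).mul (h.measurable k)).aestronglyMeasurable 1 ?_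
  filter_upwards [h.ae_eq_one_or_neg_one hp₀ hp₁ j, h.ae_eq_one_or_neg_one hp₀ hp₁ k] with ω hj hk
  rcases hj with hj | hj <;> rcases hk with hk | hk <;> simp [hj, hk]

theorem integral_mul_self (h : IsUnfairCoin P p C) (hp₀ : 0 ≤ p) (hp₁ : p ≤ 1) (j : Fin N) :
    ∫ ω, C j ω * C j ω ∂P = 1 := by
  have hae : (fun ω => C j ω * C j ω) =ᵐ[P] fun _ => 1 := by
    filter_upwards [h.ae_eq_one_or_neg_one hp₀ hp₁ j] with ω hω
    rcases hω with hω | hω <;> simp [hω]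
  simp [integral_congr_ae hae]

theorem integral_mul_of_ne (h : IsUnfairCoin P p C) (hp₀ : 0 ≤ p) (hp₁ : p ≤ 1) {j k : Fin N}
    (hjk : j ≠ k) : ∫ ω, C j ω * C k ω ∂P = (2 * p - 1) ^ 2 := by
  rw [(h.indep.indepFun hjk).integral_fun_mul_eq_mul_integral
    (h.measurable j).aestronglyMeasurable (h.measurable k).aestronglyMeasurable,
    h.integral_eq hp₀ hp₁, h.integral_eq hp₀ hp₁, sq]

/-- The second moments of unfair coin flips, in quadratic-form version. -/
theorem sum_integral_mul (h : IsUnfairCoin P p C) (hp₀ : 0 ≤ p) (hp₁ : p ≤ 1)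
    (A : Fin N → Fin N → ℝ) :
    ∑ j, ∑ k, (∫ ω, C j ω * C k ω ∂P) * A j k =
      (1 - (2 * p - 1) ^ 2) * ∑ j, A j j + (2 * p - 1) ^ 2 * ∑ j, ∑ k, A j k := by
  rw [Finset.mul_sum, Finset.mul_sum, ← Finset.sum_add_distrib]
  refine Finset.sum_congr rfl fun j _ => ?_
  rw [Finset.mul_sum, ← Finset.add_sum_erase _ _ (Finset.mem_univ j),
    ← Finset.add_sum_erase (f := fun k => (2 * p - 1) ^ 2 * A j k) _ (Finset.mem_univ j),
    h.integral_mul_self hp₀ hp₁ j]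
  rw [Finset.sum_congr rfl fun k hk =>
    by rw [h.integral_mul_of_ne hp₀ hp₁ (Finset.ne_of_mem_erase hk).symm]]
  ring

end IsUnfairCoin

/-! ### Expected mass: diagonal and coherent parts. -/

/-- Weighted mass of a wave as a quadratic form in its coefficients. -/
theorem integral_mul_sq_norm_wave {w : EuclideanSpace ℝ (Fin 2) → ℝ} (hw : Integrable w)
    (lam θ₀ : ℝ) {N : ℕ} (C : Fin N → ℝ) :
    ∫ x, w x * ‖wave lam θ₀ C x‖ ^ 2 = ∑ j, ∑ k, C j * C k *
      ∫ x, w x * Real.cos (lam * inner ℝ x (direction N θ₀ j - direction N θ₀ k)) := by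
  have hint : ∀ v : EuclideanSpace ℝ (Fin 2),
      Integrable fun x => w x * Real.cos (lam * inner ℝ x v) := fun v => by
    refine hw.mul_bdd (c := 1) ?_ (ae_of_all _ fun x => Real.abs_cos_le_one _)
    exact Continuous.aestronglyMeasurable (by fun_prop)
  simp only [sq_norm_wave, Finset.mul_sum, mul_left_comm (w _)]
  rw [integral_finsetSum _ fun j _ => integrable_finsetSum _ fun k _ => (hint _).const_mul _]
  refine Finset.sum_congr rfl fun j _ => ?_
  rw [integral_finsetSum _ fun k _ => (hint _).const_mul _]
  exact Finset.sum_congr rfl fun k _ => integral_const_mul _ _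

/-- The expected weighted mass of a random wave with unfair coin coefficients. -/
theorem IsUnfairCoin.integral_integral_mul_sq_norm_wave {Ω : Type*} [MeasurableSpace Ω]
    {P : Measure Ω} [IsProbabilityMeasure P] {p : ℝ} {N : ℕ} {C : Fin N → Ω → ℝ}
    (h : IsUnfairCoin P p C) (hp₀ : 0 ≤ p) (hp₁ : p ≤ 1)
    {w : EuclideanSpace ℝ (Fin 2) → ℝ} (hw : Integrable w) (lam θ₀ : ℝ) :
    ∫ ω, (∫ x, w x * ‖wave lam θ₀ (fun j => C j ω) x‖ ^ 2) ∂P =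
      (1 - (2 * p - 1) ^ 2) * (N * ∫ x, w x) +
        (2 * p - 1) ^ 2 * ∫ x, w x * ‖wave lam θ₀ (fun _ : Fin N => 1) x‖ ^ 2 := by
  simp only [integral_mul_sq_norm_wave hw]
  rw [integral_finsetSum _ fun j _ => integrable_finsetSum _ fun k _ =>
    (h.integrable_mul hp₀ hp₁ j k).mul_const _]
  simp only [integral_finsetSum _ fun k _ => (h.integrable_mul hp₀ hp₁ _ k).mul_const _,
    integral_mul_const]
  rw [h.sum_integral_mul hp₀ hp₁]
  simp

/-! ### Fourier transform of the Gaussian weight. -/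

theorem integrable_exp_neg_mul_sq_norm {b : ℝ} (hb : 0 < b) :
    Integrable fun x : EuclideanSpace ℝ (Fin 2) => Real.exp (-b * ‖x‖ ^ 2) := by
  have h := (GaussianFourier.integrable_cexp_neg_mul_sq_norm_add
    (V := EuclideanSpace ℝ (Fin 2)) (b := (b : ℂ)) (by simpa using hb) 0 0).norm
  refine h.congr (ae_of_all _ fun x => ?_)
  simp [Complex.norm_exp, ← Complex.ofReal_pow]

theorem integral_exp_neg_mul_sq_norm_mul_cos {b : ℝ} (hb : 0 < b) (lam : ℝ)
    (v : EuclideanSpace ℝ (Fin 2)) :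
    ∫ x : EuclideanSpace ℝ (Fin 2), Real.exp (-b * ‖x‖ ^ 2) * Real.cos (lam * inner ℝ x v) =
      Real.pi / b * Real.exp (-(lam ^ 2 * ‖v‖ ^ 2) / (4 * b)) := by
  have h := GaussianFourier.integral_cexp_neg_mul_sq_norm_add
    (V := EuclideanSpace ℝ (Fin 2)) (b := (b : ℂ)) (by simpa using hb) (lam * Complex.I) v
  have hi := GaussianFourier.integrable_cexp_neg_mul_sq_norm_add
    (V := EuclideanSpace ℝ (Fin 2)) (b := (b : ℂ)) (by simpa using hb) (lam * Complex.I) v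
  have hre : ∀ x : EuclideanSpace ℝ (Fin 2),
      Real.exp (-b * ‖x‖ ^ 2) * Real.cos (lam * inner ℝ x v) =
      RCLike.re (Complex.exp (-(b : ℂ) * (‖x‖ : ℂ) ^ 2 +
        (lam * Complex.I) * ((inner ℝ v x : ℝ) : ℂ))) := fun x => by
    have : -(b : ℂ) * (‖x‖ : ℂ) ^ 2 + (lam * Complex.I) * ((inner ℝ v x : ℝ) : ℂ) =
        ⟨-b * ‖x‖ ^ 2, lam * inner ℝ x v⟩ := by
      rw [real_inner_comm]
      apply Complex.ext <;> simp [← Complex.ofReal_pow]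
    rw [this]
    simp [Complex.exp_re]
  simp only [hre]
  rw [integral_re hi, h]
  have : (Real.pi / (b : ℂ)) ^ ((Module.finrank ℝ (EuclideanSpace ℝ (Fin 2)) : ℂ) / 2) *
      Complex.exp ((lam * Complex.I) ^ 2 * (‖v‖ : ℂ) ^ 2 / (4 * b)) =
      ((Real.pi / b * Real.exp (-(lam ^ 2 * ‖v‖ ^ 2) / (4 * b)) : ℝ) : ℂ) := by
    simp [mul_pow]
  rw [this]
  exact Complex.ofReal_re _

/-! ### Chords between equi-spaced directions. -/

theorem sq_norm_direction_sub (N : ℕ) (θ₀ : ℝ) (j k : Fin N) :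
    ‖direction N θ₀ j - direction N θ₀ k‖ ^ 2 =
      2 - 2 * Real.cos (2 * Real.pi * ((j : ℕ) - (k : ℕ) : ℝ) / N) := by
  have : 2 * Real.pi * ((j : ℕ) - (k : ℕ) : ℝ) / N =
      (θ₀ + 2 * Real.pi * (j : ℕ) / N) - (θ₀ + 2 * Real.pi * (k : ℕ) / N) := by ring
  rw [this, Real.cos_sub, EuclideanSpace.norm_sq_eq]
  simp only [direction, Fin.sum_univ_two, Real.norm_eq_abs, sq_abs, PiLp.sub_apply]
  simp only [Matrix.cons_val_zero, Matrix.cons_val_one]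
  nlinarith [Real.sin_sq_add_cos_sq (θ₀ + 2 * Real.pi * (j : ℕ) / N),
    Real.sin_sq_add_cos_sq (θ₀ + 2 * Real.pi * (k : ℕ) / N)]

/-- The chord between two equi-spaced directions depends only on their cyclic difference. -/
theorem sq_norm_direction_sub_eq_sin (N : ℕ) [NeZero N] (θ₀ : ℝ) (j k : Fin N) :
    ‖direction N θ₀ j - direction N θ₀ k‖ ^ 2 =
      4 * Real.sin (Real.pi * ((j - k : Fin N) : ℕ) / N) ^ 2 := by
  have hN : (N : ℝ) ≠ 0 := NeZero.ne _
  have hcos : Real.cos (2 * Real.pi * ((j : ℕ) - (k : ℕ) : ℝ) / N) =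
      Real.cos (2 * (Real.pi * ((j - k : Fin N) : ℕ) / N)) := by
    rcases le_or_gt k j with hkj | hkj
    · rw [Fin.coe_sub_iff_le.2 hkj, Nat.cast_sub hkj]
      ring_nf
    -- Subtraction wraps around here, adding `N` to the index and a full turn to the angle.
    · rw [Fin.coe_sub_iff_lt.2 hkj, Nat.cast_sub (by omega), Nat.cast_add,
        ← Real.cos_add_two_pi]
      congr 1
      field_simp
      ring
  rw [sq_norm_direction_sub, hcos, Real.cos_two_mul, Real.cos_sq']
  ring

/-! ### Row sums of the quadratic form. -/

theorem sum_range_one_div_one_add_sq_le {s : ℝ} (hs : 0 < s) (n : ℕ) :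
    ∑ m ∈ Finset.range (n + 1), 1 / (1 + (s * m) ^ 2) ≤ 1 + 2 / s := by
  -- Strengthened to a telescoping bound; the inductive step rests on `(1 + y)² ≤ 2(1 + y²)`.
  suffices h : ∑ m ∈ Finset.range (n + 1), 1 / (1 + (s * m) ^ 2) ≤
      1 + 2 / s * (1 - 1 / (1 + s * n)) by
    have : 0 ≤ 2 / s * (1 / (1 + s * n)) := by positivity
    linarith
  induction n with
  | zero => simp
  | succ n ih =>
    rw [Finset.sum_range_succ]
    have hstep : 1 / (1 + (s * (n + 1 : ℕ)) ^ 2) ≤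
        2 / s * (1 / (1 + s * n) - 1 / (1 + s * (n + 1 : ℕ))) := by
      have heq : 2 / s * (1 / (1 + s * n) - 1 / (1 + s * (n + 1 : ℕ))) =
          2 / ((1 + s * n) * (1 + s * (n + 1 : ℕ))) := by
        push_cast
        field_simp
        ring
      rw [heq, div_le_div_iff₀ (by positivity) (by positivity)]
      push_cast
      have : 0 ≤ s * n := by positivity
      nlinarith [sq_nonneg (s * (n + 1) - 1)]
    linarith

theorem exp_neg_sq_le_one_div (y : ℝ) : Real.exp (-y ^ 2) ≤ 1 / (1 + y ^ 2) := by
  rw [Real.exp_neg, ← one_div]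
  exact one_div_le_one_div_of_le (by positivity) (by linarith [Real.add_one_le_exp (y ^ 2)])

/-- Jordan's inequality `sin x ≥ 2x/π` handles `m ≤ N/2`; the symmetry `m ↦ N - m` handles the rest.
Each half costs `1 + N/t`. -/
theorem sum_range_exp_neg_sin_sq_le (N : ℕ) [NeZero N] {t : ℝ} (ht : 0 < t) :
    ∑ m ∈ Finset.range N, Real.exp (-(t * Real.sin (Real.pi * m / N)) ^ 2) ≤
      2 * (1 + N / t) := by
  have hN : (0 : ℝ) < N := Nat.cast_pos.2 (NeZero.pos N)
  set s : ℝ := 2 * t / N with hs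
  have hs0 : 0 < s := by positivity
  have hjordan : ∀ m : ℕ, 2 * m ≤ N → s * m ≤ t * Real.sin (Real.pi * m / N) := fun m hm => by
    have hm' : 2 * (m : ℝ) ≤ N := by exact_mod_cast hm
    have := Real.mul_le_sin (x := Real.pi * m / N) (by positivity) (by
      rw [div_le_div_iff₀ hN two_pos]; nlinarith [Real.pi_pos])
    have heq : 2 / Real.pi * (Real.pi * m / N) = 2 * m / N := by
      field_simp
    rw [heq] at this
    calc s * m = t * (2 * m / N) := by rw [hs]; ring
      _ ≤ _ := by gcongr
  have hdec : ∀ {x y : ℝ}, 0 ≤ x → x ≤ y → Real.exp (-y ^ 2) ≤ 1 / (1 + x ^ 2) := fun hx hxy =>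
    (exp_neg_sq_le_one_div _).trans (one_div_le_one_div_of_le (by positivity) (by gcongr))
  have hterm : ∀ m ∈ Finset.range N, Real.exp (-(t * Real.sin (Real.pi * m / N)) ^ 2) ≤
      1 / (1 + (s * m) ^ 2) + 1 / (1 + (s * (N - m : ℕ)) ^ 2) := fun m hm => by
    have hmN : m ≤ N := (Finset.mem_range.1 hm).le
    have h1 : 0 ≤ 1 / (1 + (s * m) ^ 2) := by positivity
    have h2 : 0 ≤ 1 / (1 + (s * (N - m : ℕ)) ^ 2) := by positivity
    rcases le_total (2 * m) N with h | h
    · linarith [hdec (by positivity) (hjordan m h)]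
    · have hsin : Real.sin (Real.pi * m / N) = Real.sin (Real.pi * (N - m : ℕ) / N) := by
        rw [← Real.sin_pi_sub, Nat.cast_sub hmN]
        congr 1
        field_simp
      rw [hsin]
      linarith [hdec (by positivity) (hjordan (N - m) (by omega))]
  -- Reflection sends `0, …, N-1` to `N, …, 1`, hence the range `N + 1` on the right.
  have hreflect : ∑ m ∈ Finset.range N, 1 / (1 + (s * (N - m : ℕ)) ^ 2) ≤
      ∑ m ∈ Finset.range (N + 1), 1 / (1 + (s * m) ^ 2) := by
    rw [← Finset.sum_range_reflect _ (N + 1)]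
    simp only [Nat.add_sub_cancel]
    exact Finset.sum_le_sum_of_subset_of_nonneg (Finset.range_mono N.le_succ)
      fun _ _ _ => by positivity
  have hmono : ∑ m ∈ Finset.range N, 1 / (1 + (s * m) ^ 2) ≤
      ∑ m ∈ Finset.range (N + 1), 1 / (1 + (s * m) ^ 2) :=
    Finset.sum_le_sum_of_subset_of_nonneg (Finset.range_mono N.le_succ)
      fun _ _ _ => by positivity
  have hsum := sum_range_one_div_one_add_sq_le hs0 N
  have hs' : 2 / s = N / t := by rw [hs]; field_simp
  calc _ ≤ _ := Finset.sum_le_sum hterm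
    _ ≤ _ := by rw [Finset.sum_add_distrib]; linarith

/-- Gaussian-weighted mass of the wave all of whose coefficients are `1`. -/
theorem integral_exp_mul_sq_norm_wave_one_le {lam R : ℝ} (hlam : 0 < lam) (hR : 0 < R) (θ₀ : ℝ)
    (N : ℕ) [NeZero N] :
    ∫ x, Real.exp (-(1 / R ^ 2) * ‖x‖ ^ 2) * ‖wave lam θ₀ (fun _ : Fin N => 1) x‖ ^ 2 ≤
      Real.pi * R ^ 2 * (N * (2 * (1 + N / (lam * R)))) := by
  have hb : 0 < 1 / R ^ 2 := by positivity
  have hrow : ∀ k : Fin N, ∑ j, Real.pi / (1 / R ^ 2) * Real.exp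
      (-(lam ^ 2 * ‖direction N θ₀ j - direction N θ₀ k‖ ^ 2) / (4 * (1 / R ^ 2))) ≤
      Real.pi * R ^ 2 * (2 * (1 + N / (lam * R))) := fun k => by
    have heq : ∀ j : Fin N,
        -(lam ^ 2 * ‖direction N θ₀ j - direction N θ₀ k‖ ^ 2) / (4 * (1 / R ^ 2)) =
        -(lam * R * Real.sin (Real.pi * ((j - k : Fin N) : ℕ) / N)) ^ 2 := fun j => by
      rw [sq_norm_direction_sub_eq_sin]
      field_simp
    simp only [heq, ← Finset.mul_sum]
    -- The shift `j ↦ j - k` permutes the indices, so all rows have the same sum.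
    have hshift := (Equiv.subRight k).sum_comp fun m : Fin N =>
      Real.exp (-(lam * R * Real.sin (Real.pi * (m : ℕ) / N)) ^ 2)
    simp only [Equiv.subRight_apply] at hshift
    rw [hshift,
      Fin.sum_univ_eq_sum_range fun m : ℕ =>
        Real.exp (-(lam * R * Real.sin (Real.pi * m / N)) ^ 2), div_div_eq_mul_div, div_one]
    gcongr
    exact sum_range_exp_neg_sin_sq_le N (by positivity)
  rw [integral_mul_sq_norm_wave (integrable_exp_neg_mul_sq_norm hb), Finset.sum_comm]
  simp only [integral_exp_neg_mul_sq_norm_mul_cos hb, one_mul]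
  refine (Finset.sum_le_sum fun k _ => hrow k).trans_eq ?_
  simp
  ring

/-! ### Mass bounds for the normalized wave. -/

theorem continuous_wave (lam θ₀ : ℝ) {N : ℕ} (C : Fin N → ℝ) : Continuous (wave lam θ₀ C) := by
  unfold wave
  fun_prop

theorem norm_wave_one_le (lam θ₀ : ℝ) (N : ℕ) (x : EuclideanSpace ℝ (Fin 2)) :
    ‖wave lam θ₀ (fun _ : Fin N => 1) x‖ ≤ N := by
  refine (norm_sum_le _ _).trans_eq ?_
  simp [mul_comm Complex.I, -Complex.ofReal_mul, Complex.norm_exp_ofReal_mul_I]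

theorem sq_norm_normalizedWave {lam γ : ℝ} (hlam : 0 < lam) (hγ : 0 < γ) (θ₀ : ℝ) {N : ℕ}
    (hN : (N : ℝ) = γ * lam) (C : Fin N → ℝ) (x : EuclideanSpace ℝ (Fin 2)) :
    ‖normalizedWave lam γ θ₀ C x‖ ^ 2 = (N : ℝ)⁻¹ * ‖wave lam θ₀ C x‖ ^ 2 := by
  have hsq : ∀ {y : ℝ}, 0 < y → (y ^ (-(1 / 2) : ℝ)) ^ 2 = y⁻¹ := fun hy => by
    rw [← Real.rpow_natCast, ← Real.rpow_mul hy.le, ← Real.rpow_neg_one]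
    norm_num
  rw [normalizedWave, norm_mul, mul_pow, Complex.norm_real, Real.norm_eq_abs, sq_abs, mul_pow,
    hsq hγ, hsq hlam, hN, mul_inv]

theorem volume_real_ball_fin_two {R : ℝ} (hR : 0 ≤ R) :
    volume.real (Metric.ball (0 : EuclideanSpace ℝ (Fin 2)) R) = Real.pi * R ^ 2 := by
  rw [measureReal_def, EuclideanSpace.volume_ball_fin_two, ENNReal.toReal_mul, ENNReal.toReal_pow,
    ENNReal.toReal_ofReal hR, ENNReal.toReal_ofReal Real.pi_pos.le, mul_comm]

/-- Two-sided bound for the expected mass of the normalized wave against a weight squeezed between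
the indicator of a disc and a multiple of a Gaussian of the same width. -/
theorem IsUnfairCoin.expected_weighted_mass_bounds {Ω : Type*} [MeasurableSpace Ω]
    {P : Measure Ω} [IsProbabilityMeasure P] {p : ℝ} {N : ℕ} {C : Fin N → Ω → ℝ}
    (h : IsUnfairCoin P p C) (hp₀ : 0 ≤ p) (hp₁ : p ≤ 1) {lam γ R K M : ℝ} (hlam : 1 ≤ lam)
    (hγ : 1 ≤ γ) (hN : (N : ℝ) = γ * lam) (hR₀ : 0 < R) (hR₁ : R ≤ 1) (hM : 0 ≤ M)
    (hq : (2 * p - 1) ^ 2 ≤ 4 * K ^ 2 * R / γ) (hq' : (2 * p - 1) ^ 2 ≤ 1 / 2) (θ₀ : ℝ)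
    {w : EuclideanSpace ℝ (Fin 2) → ℝ} (hw : Integrable w)
    (hlow : ∀ x, (Metric.ball 0 R).indicator 1 x ≤ w x)
    (hup : ∀ x, w x ≤ M * Real.exp (-(1 / R ^ 2) * ‖x‖ ^ 2)) :
    1 / 2 * volume.real (Metric.ball (0 : EuclideanSpace ℝ (Fin 2)) R) ≤
        ∫ ω, (∫ x, w x * ‖normalizedWave lam γ θ₀ (fun j => C j ω) x‖ ^ 2) ∂P ∧
      ∫ ω, (∫ x, w x * ‖normalizedWave lam γ θ₀ (fun j => C j ω) x‖ ^ 2) ∂P ≤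
        M * (1 + 16 * K ^ 2) * volume.real (Metric.ball (0 : EuclideanSpace ℝ (Fin 2)) R) := by
  have hlam₀ : 0 < lam := by linarith
  have hγ₀ : 0 < γ := by linarith
  have hN₀ : (0 : ℝ) < N := by rw [hN]; positivity
  have : NeZero N := ⟨by rintro rfl; simp at hN₀⟩
  have hb : 0 < 1 / R ^ 2 := by positivity
  have hw₀ : ∀ x, 0 ≤ w x := fun x =>
    (Set.indicator_nonneg (fun _ _ => zero_le_one) x).trans (hlow x)
  have hg := integrable_exp_neg_mul_sq_norm hb
  set S := fun x => ‖wave lam θ₀ (fun _ : Fin N => 1) x‖ ^ 2 with hS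
  have hgS : Integrable fun x => Real.exp (-(1 / R ^ 2) * ‖x‖ ^ 2) * S x := by
    refine hg.mul_bdd (c := (N : ℝ) ^ 2)
      ((continuous_wave _ _ _).norm.pow 2).aestronglyMeasurable (ae_of_all _ fun x => ?_)
    rw [hS, norm_pow, norm_norm]
    gcongr
    exact norm_wave_one_le _ _ _ _
  have hball : Real.pi * R ^ 2 ≤ ∫ x, w x := by
    have hm : MeasurableSet (Metric.ball (0 : EuclideanSpace ℝ (Fin 2)) R) := measurableSet_ball
    rw [← volume_real_ball_fin_two hR₀.le, ← integral_indicator_one hm]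
    refine integral_mono ?_ hw hlow
    exact (integrable_indicator_iff hm).2 (integrableOn_const measure_ball_lt_top.ne)
  have hw_le : ∫ x, w x ≤ M * (Real.pi * R ^ 2) := by
    have hG := integral_exp_neg_mul_sq_norm_mul_cos hb 0 0
    simp only [zero_mul, Real.cos_zero, mul_one, norm_zero, ne_eq, OfNat.ofNat_ne_zero,
      not_false_eq_true, zero_pow, neg_zero, zero_div, Real.exp_zero, div_div_eq_mul_div,
      div_one] at hG
    rw [← hG, ← integral_const_mul]
    exact integral_mono hw (hg.const_mul M) hup
  have hwS₀ : 0 ≤ ∫ x, w x * S x := integral_nonneg fun x => mul_nonneg (hw₀ x) (by positivity)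
  have hwS : ∫ x, w x * S x ≤ M * (Real.pi * R ^ 2 * (N * (2 * (1 + N / (lam * R))))) := by
    calc ∫ x, w x * S x ≤ ∫ x, M * (Real.exp (-(1 / R ^ 2) * ‖x‖ ^ 2) * S x) := by
          refine integral_mono_of_nonneg (ae_of_all _ fun x => mul_nonneg (hw₀ x) (by positivity))
            (hgS.const_mul M) (ae_of_all _ fun x => ?_)
          simp only [← mul_assoc]
          exact mul_le_mul_of_nonneg_right (hup x) (by positivity)
      _ ≤ _ := by
          rw [integral_const_mul]
          exact mul_le_mul_of_nonneg_left
            (integral_exp_mul_sq_norm_wave_one_le hlam₀ hR₀ θ₀ N) hM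
  have hmass : ∫ ω, (∫ x, w x * ‖normalizedWave lam γ θ₀ (fun j => C j ω) x‖ ^ 2) ∂P =
      (1 - (2 * p - 1) ^ 2) * (∫ x, w x) + (2 * p - 1) ^ 2 * ((N : ℝ)⁻¹ * ∫ x, w x * S x) := by
    simp only [sq_norm_normalizedWave hlam₀ hγ₀ θ₀ hN, mul_left_comm (w _), integral_const_mul]
    rw [h.integral_integral_mul_sq_norm_wave hp₀ hp₁ hw]
    field_simp
    rfl
  have hq₀ : 0 ≤ (2 * p - 1) ^ 2 := sq_nonneg _
  rw [hmass, volume_real_ball_fin_two hR₀.le]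
  have hV : 0 ≤ Real.pi * R ^ 2 := by positivity
  constructor
  · have h1 : 1 / 2 * (Real.pi * R ^ 2) ≤ (1 - (2 * p - 1) ^ 2) * ∫ x, w x :=
      mul_le_mul (by linarith) hball hV (by linarith)
    have h2 : 0 ≤ (2 * p - 1) ^ 2 * ((N : ℝ)⁻¹ * ∫ x, w x * S x) := by positivity
    linarith
  · have h1 : (1 - (2 * p - 1) ^ 2) * ∫ x, w x ≤ 1 * (M * (Real.pi * R ^ 2)) :=
      mul_le_mul (by linarith) hw_le (hV.trans hball) zero_le_one
    -- As `R ≤ 1 ≤ γ`, the summand `1` is absorbed into `γ / R`.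
    have hratio : 1 + N / (lam * R) ≤ 2 * (γ / R) := by
      have : N / (lam * R) = γ / R := by rw [hN]; field_simp
      have : 1 ≤ γ / R := (one_le_div hR₀).2 (hR₁.trans hγ)
      linarith
    have h2 : (N : ℝ)⁻¹ * ∫ x, w x * S x ≤ M * (Real.pi * R ^ 2) * (4 * (γ / R)) := by
      rw [inv_mul_le_iff₀ hN₀]
      refine hwS.trans ?_
      calc M * (Real.pi * R ^ 2 * (N * (2 * (1 + N / (lam * R)))))
          ≤ M * (Real.pi * R ^ 2 * (N * (2 * (2 * (γ / R))))) := by gcongr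
        _ = _ := by ring
    have h3 : (2 * p - 1) ^ 2 * ((N : ℝ)⁻¹ * ∫ x, w x * S x) ≤
        4 * K ^ 2 * R / γ * (M * (Real.pi * R ^ 2) * (4 * (γ / R))) :=
      mul_le_mul hq h2 (by positivity) (hq₀.trans hq)
    have h4 : 4 * K ^ 2 * R / γ * (M * (Real.pi * R ^ 2) * (4 * (γ / R))) =
        16 * K ^ 2 * (M * (Real.pi * R ^ 2)) := by
      field_simp
      ring
    linarith

theorem sq_two_mul_sub_one_le {p K lam γ α : ℝ} (hlam : 0 < lam) (hγ : 0 < γ)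
    (hp : |p - 1 / 2| ≤ K * lam ^ (-(α / 2)) * γ ^ (-(1 / 2) : ℝ)) :
    (2 * p - 1) ^ 2 ≤ 4 * K ^ 2 * lam ^ (-α) / γ := by
  have h1 : (lam ^ (-(α / 2))) ^ 2 = lam ^ (-α) := by
    rw [← Real.rpow_natCast, ← Real.rpow_mul hlam.le]
    congr 1
    push_cast
    ring
  have h2 : (γ ^ (-(1 / 2) : ℝ)) ^ 2 = γ⁻¹ := by
    rw [← Real.rpow_natCast, ← Real.rpow_mul hγ.le, ← Real.rpow_neg_one]
    norm_num
  have h3 := pow_le_pow_left₀ (abs_nonneg _) hp 2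
  rw [sq_abs, mul_pow, mul_pow, h1, h2] at h3
  calc (2 * p - 1) ^ 2 = 4 * (p - 1 / 2) ^ 2 := by ring
    _ ≤ 4 * (K ^ 2 * lam ^ (-α) * γ⁻¹) := by gcongr
    _ = _ := by ring

/-! ### Squeezing the cut-off between a disc and a Gaussian. -/

namespace IsSmoothCutoff

variable {a : ℝ → ℝ}

theorem exists_sq_le (ha : IsSmoothCutoff a) : ∃ M, 1 ≤ M ∧ ∀ r, a r ^ 2 ≤ M := by
  obtain ⟨B, hB⟩ := isCompact_Icc.exists_bound_of_continuousOn
    (s := Set.Icc (-2 : ℝ) 2) ha.smooth.continuous.continuousOn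
  refine ⟨max 1 (B ^ 2), le_max_left _ _, fun r => ?_⟩
  by_cases hr : r ∈ Set.Icc (-2 : ℝ) 2
  · refine le_trans ?_ (le_max_right _ _)
    rw [← sq_abs]
    exact pow_le_pow_left₀ (abs_nonneg _) (hB r hr) 2
  · have : a r = 0 := by
      by_contra h0
      exact hr (ha.support_subset h0)
    simp [this]

/-- On the support `R⁻¹‖x‖ ≤ 2`, so the Gaussian is at least `exp (-4)` there. -/
theorem sq_le_exp (ha : IsSmoothCutoff a) {M R : ℝ} (hR : 0 < R) (hM : ∀ r, a r ^ 2 ≤ M)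
    (hM₁ : 1 ≤ M) (x : EuclideanSpace ℝ (Fin 2)) :
    a (R⁻¹ * ‖x‖) ^ 2 ≤ M * Real.exp 4 * Real.exp (-(1 / R ^ 2) * ‖x‖ ^ 2) := by
  by_cases h0 : a (R⁻¹ * ‖x‖) = 0
  · rw [h0, zero_pow two_ne_zero]
    positivity
  · have h2 : R⁻¹ * ‖x‖ ≤ 2 := (ha.support_subset h0).2
    have h4 : (R⁻¹ * ‖x‖) ^ 2 ≤ 2 ^ 2 := pow_le_pow_left₀ (by positivity) h2 2
    have h5 : 1 / R ^ 2 * ‖x‖ ^ 2 = (R⁻¹ * ‖x‖) ^ 2 := by field_simp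
    refine (hM _).trans ?_
    rw [mul_assoc, ← Real.exp_add]
    exact le_mul_of_one_le_right (by positivity) (Real.one_le_exp (by linarith))

theorem indicator_le_sq (ha : IsSmoothCutoff a) {R : ℝ} (hR : 0 < R)
    (x : EuclideanSpace ℝ (Fin 2)) :
    (Metric.ball 0 R).indicator 1 x ≤ a (R⁻¹ * ‖x‖) ^ 2 := by
  refine Set.indicator_apply_le' (fun hx => ?_) fun _ => sq_nonneg _
  rw [mem_ball_zero_iff] at hx
  have h0 : 0 ≤ R⁻¹ * ‖x‖ := by positivity
  rw [ha.eq_one _ ⟨by linarith, (inv_mul_le_one₀ hR).2 hx.le⟩]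
  simp

end IsSmoothCutoff

/-! ### The main theorem. -/

theorem mainTheorem6 (a : ℝ → ℝ) (ha : IsSmoothCutoff a) (α : ℝ) (hα : 0 ≤ α)
    (K : ℝ) (hK : 0 < K) :
    ∃ c C γ₀ : ℝ, 0 < c ∧ 0 < C ∧ 0 < γ₀ ∧
      ∀ (lam γ : ℝ) (N : ℕ), 1 ≤ lam → γ₀ ≤ γ → (N : ℝ) = γ * lam →
      ∀ p : ℝ, 0 ≤ p → p ≤ 1 → |p - 1 / 2| ≤ K * lam ^ (-(α / 2)) * γ ^ (-(1 / 2) : ℝ) →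
      ∀ (θ₀ : ℝ) (Ω : Type*) [MeasurableSpace Ω] (P : Measure Ω) [IsProbabilityMeasure P]
        (coin : Fin N → Ω → ℝ), IsUnfairCoin P p coin →
      (c * volume.real (Metric.ball (0 : EuclideanSpace ℝ (Fin 2)) (lam ^ (-α))) ≤
          ∫ ω, smoothedMass a lam α (normalizedWave lam γ θ₀ (fun j => coin j ω)) ∂P ∧
        ∫ ω, smoothedMass a lam α (normalizedWave lam γ θ₀ (fun j => coin j ω)) ∂P ≤
          C * volume.real (Metric.ball (0 : EuclideanSpace ℝ (Fin 2)) (lam ^ (-α)))) ∧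
      (c * volume.real (Metric.ball (0 : EuclideanSpace ℝ (Fin 2)) (lam ^ (-α))) ≤
          ∫ ω, massOn (Metric.ball 0 (lam ^ (-α)))
            (normalizedWave lam γ θ₀ (fun j => coin j ω)) ∂P ∧
        ∫ ω, massOn (Metric.ball 0 (lam ^ (-α)))
            (normalizedWave lam γ θ₀ (fun j => coin j ω)) ∂P ≤
          C * volume.real (Metric.ball (0 : EuclideanSpace ℝ (Fin 2)) (lam ^ (-α)))) := by

  obtain ⟨M, hM₁, hM⟩ := ha.exists_sq_le
  -- `γ ≥ 8K²` forces `q ≤ 1/2`, which gives `c = 1/2`; `γ ≥ 1` is what absorbs lower-order terms.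
  refine ⟨1 / 2, M * Real.exp 4 * (1 + 16 * K ^ 2), max 1 (8 * K ^ 2), by norm_num,
    by positivity, by positivity, ?_⟩
  intro lam γ N hlam hγ hN p hp₀ hp₁ hp θ₀ Ω _ P _ coin hcoin
  have hγ₁ : 1 ≤ γ := (le_max_left _ _).trans hγ
  have hγK : 8 * K ^ 2 ≤ γ := (le_max_right _ _).trans hγ
  have hlam₀ : 0 < lam := by linarith
  have hγ₀ : 0 < γ := by linarith
  have hR₀ : 0 < lam ^ (-α) := Real.rpow_pos_of_pos hlam₀ _
  have hR₁ : lam ^ (-α) ≤ 1 := Real.rpow_le_one_of_one_le_of_nonpos hlam (by linarith)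
  have hq := sq_two_mul_sub_one_le hlam₀ hγ₀ hp
  have hq' : (2 * p - 1) ^ 2 ≤ 1 / 2 := by
    refine hq.trans ((div_le_iff₀ hγ₀).2 ?_)
    have := mul_le_mul_of_nonneg_left hR₁ (by positivity : 0 ≤ 4 * K ^ 2)
    linarith
  have hpow : lam ^ α = (lam ^ (-α))⁻¹ := by rw [Real.rpow_neg hlam₀.le, inv_inv]
  have hM₀ : 0 ≤ M * Real.exp 4 := by positivity
  have hm : MeasurableSet (Metric.ball (0 : EuclideanSpace ℝ (Fin 2)) (lam ^ (-α))) :=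
    measurableSet_ball
  have hmassOn : ∀ v : EuclideanSpace ℝ (Fin 2) → ℂ, massOn (Metric.ball 0 (lam ^ (-α))) v =
      ∫ x, (Metric.ball 0 (lam ^ (-α))).indicator 1 x * ‖v x‖ ^ 2 := fun v => by
    rw [massOn, ← integral_indicator hm]
    refine integral_congr_ae (ae_of_all _ fun x => ?_)
    by_cases hx : x ∈ Metric.ball (0 : EuclideanSpace ℝ (Fin 2)) (lam ^ (-α)) <;>
      simp only [Set.indicator, hx, if_true, if_false, Pi.one_apply, one_mul, zero_mul]
  simp only [smoothedMass, hmassOn, hpow]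
  -- The disc's indicator lies below the squared cut-off, so the same Gaussian majorant and
  -- constants serve both masses.
  refine ⟨hcoin.expected_weighted_mass_bounds hp₀ hp₁ hlam hγ₁ hN hR₀ hR₁ hM₀ hq hq' θ₀ ?_
      (ha.indicator_le_sq hR₀) (ha.sq_le_exp hR₀ hM hM₁),
    hcoin.expected_weighted_mass_bounds hp₀ hp₁ hlam hγ₁ hN hR₀ hR₁ hM₀ hq hq' θ₀ ?_
      (fun _ => le_rfl) fun x => (ha.indicator_le_sq hR₀ x).trans (ha.sq_le_exp hR₀ hM hM₁ x)⟩
  · have hcont : Continuous fun x : EuclideanSpace ℝ (Fin 2) =>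
        a ((lam ^ (-α))⁻¹ * ‖x‖) ^ 2 :=
      (ha.smooth.continuous.comp (continuous_const.mul continuous_norm)).pow 2
    refine ((integrable_exp_neg_mul_sq_norm (b := 1 / (lam ^ (-α)) ^ 2)
      (by positivity)).const_mul (M * Real.exp 4)).mono' hcont.aestronglyMeasurable
      (ae_of_all _ fun x => ?_)
    rw [Real.norm_of_nonneg (sq_nonneg _)]
    exact ha.sq_le_exp hR₀ hM hM₁ x
  · exact (integrable_indicator_iff hm).2 (integrableOn_const measure_ball_lt_top.ne)
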